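/- Let $\mathbb X$ be a Banach space over $\mathbb F=\mathbb R$ or $\mathbb C$, and let $\mathcal B=(e_n)_{n\ge 1}$ be a semi-normalized Schauder basis of $\mathbb X$ with biorthogonal functionals $(e_n^*)_{n\ge 1}$; that is, $e_n^*\in\mathbb X^*$, $e_i^*(e_j)=\delta_{ij}$, $x=\sum_{n=1}^\infty e_n^*(x)e_n$ in norm for every $x\in\mathbb X$, and $0<\inf_n\|e_n\|\le\sup_n\|e_n\|<\infty$. For $x\in\mathbb X$, a natural greedy ordering of $x$ is a map $\rho:\mathbb N\to\mathbb N$ with $\{n: e_n^*(x)\ne 0\}\subset\rho(\mathbb N)$ such that for $j<k$ either $|e^*_{\rho(j)}(x)|>|e^*_{\rho(k)}(x)|$, or $|e^*_{\rho(j)}(x)|=|e^*_{\rho(k)}(x)|$ and $\rho(j)<\rho(k)$. With $A_m(x)=\{\rho(1),\dots,\rho(m)\}$, put $\mathcal G_m(x)=\sum_{n\in A_m(x)}e_n^*(x)e_n$, and let $\mathcal{CG}_m(x)$ be any element of $\mathrm{span}\{e_n:n\in A_m(x)\}$ with $\|x-\mathcal{CG}_m(x)\|=\min\{\|x-\sum_{n\in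 A_m(x)}a_ne_n\|:a_n\in\mathbb F\}$. Let $$\sigma_m(x)=\inf\Big\{\Big\|x-\sum_{n\in A}a_ne_n\Big\|: |A|=m,\ a_n\in\mathbb F\Big\},\qquad \tilde\sigma_m(x)=\inf\Big\{\Big\|x-\sum_{n\in A}e_n^*(x)e_n\Big\|:|A|=m\Big\}.$$ The basis $\mathcal B$ is almost-greedy if there is a constant $C\ge 1$ such that $\|x-\mathcal G_m(x)\|\le C\,\tilde\sigma_m(x)$ for all $x\in\mathbb X$ and all $m$. It is semi-greedy if there is a constant $C\ge 1$ such that $\|x-\mathcal{CG}_m(x)\|\le C\,\sigma_m(x)$ for all $x\in\mathbb X$, all $m$ and every choice of $\mathcal{CG}_m(x)$. Then $\mathcal B$ is almost-greedy if and only if $\mathcal B$ is semi-greedy. -/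

import Mathlib

open Filter Topology

/-! Throughout, `b : SchauderBasis 𝕜 X` is Mathlib's classical Schauder basis, indexed by `ℕ`
(starting at `0`), with basis vectors `b n` and biorthogonal functionals `b.coord n`. -/

namespace SchauderBasis

variable {𝕜 X : Type*} [RCLike 𝕜] [NormedAddCommGroup X] [NormedSpace 𝕜 X]

/-- `0 < inf ‖e_n‖ ≤ sup ‖e_n‖ < ∞`. -/
def IsSemiNormalized (b : SchauderBasis 𝕜 X) : Prop :=
  ∃ c C : ℝ, 0 < c ∧ ∀ n : ℕ, c ≤ ‖b n‖ ∧ ‖b n‖ ≤ C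

/-- `ρ` is a natural greedy ordering for `x`: its range contains the support of `x`, and it
lists the coefficients by decreasing modulus, ties being broken by the smaller index. -/
def IsGreedyOrdering (b : SchauderBasis 𝕜 X) (x : X) (ρ : ℕ → ℕ) : Prop :=
  {n : ℕ | b.coord n x ≠ 0} ⊆ Set.range ρ ∧
    ∀ j k : ℕ, j < k →
      ‖b.coord (ρ k) x‖ < ‖b.coord (ρ j) x‖ ∨
        (‖b.coord (ρ j) x‖ = ‖b.coord (ρ k) x‖ ∧ ρ j < ρ k)

/-- The set of the first `m` values of `ρ`; this is the greedy set `A_m(x)` if `ρ` is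
the greedy ordering for `x`. -/
def greedySet (ρ : ℕ → ℕ) (m : ℕ) : Finset ℕ := (Finset.range m).image ρ

/-- The greedy sum `G_m(x) = ∑_{j < m} e*_{ρ j}(x) e_{ρ j}`, for the greedy ordering `ρ` of `x`. -/
noncomputable def greedySum (b : SchauderBasis 𝕜 X) (x : X) (ρ : ℕ → ℕ) (m : ℕ) : X :=
  ∑ j ∈ Finset.range m, b.coord (ρ j) x • b (ρ j)

/-- `y` is a Chebyshev-greedy sum of `x` on the finite set `A`: a best approximation to `x`
from the span of the `e_i`, `i ∈ A`. -/
def IsChebyshevSum (b : SchauderBasis 𝕜 X) (x : X) (A : Finset ℕ) (y : X) : Prop :=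
  y ∈ Submodule.span 𝕜 (b.basis '' (A : Set ℕ)) ∧
    ∀ a : ℕ → 𝕜, ‖x - y‖ ≤ ‖x - ∑ n ∈ A, a n • b n‖

/-- The error `σ_m(x)` of the best `m`-term approximation. -/
noncomputable def sigma (b : SchauderBasis 𝕜 X) (m : ℕ) (x : X) : ℝ :=
  sInf {r : ℝ | ∃ (A : Finset ℕ) (a : ℕ → 𝕜), A.card = m ∧ r = ‖x - ∑ n ∈ A, a n • b n‖}

/-- The error `σ̃_m(x)` of the best `m`-term approximation by projections. -/
noncomputable def sigmaTilde (b : SchauderBasis 𝕜 X) (m : ℕ) (x : X) : ℝ :=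
  sInf {r : ℝ | ∃ A : Finset ℕ, A.card = m ∧ r = ‖x - ∑ n ∈ A, b.coord n x • b n‖}

/-- Almost-greedy bases. -/
def IsAlmostGreedy (b : SchauderBasis 𝕜 X) : Prop :=
  ∃ C : ℝ, 1 ≤ C ∧ ∀ (x : X) (ρ : ℕ → ℕ), b.IsGreedyOrdering x ρ →
    ∀ m : ℕ, ‖x - b.greedySum x ρ m‖ ≤ C * b.sigmaTilde m x

/-- Semi-greedy bases. -/
def IsSemiGreedy (b : SchauderBasis 𝕜 X) : Prop :=
  ∃ C : ℝ, 1 ≤ C ∧ ∀ (x : X) (ρ : ℕ → ℕ), b.IsGreedyOrdering x ρ →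
    ∀ (m : ℕ) (y : X), b.IsChebyshevSum x (greedySet ρ m) y →
      ‖x - y‖ ≤ C * b.sigma m x

/-- The coefficients of a vector with respect to a semi-normalized basis tend to `0`. -/
theorem tendsto_norm_coord (b : SchauderBasis 𝕜 X) (hb : b.IsSemiNormalized) (x : X) :
    Tendsto (fun n => ‖b.coord n x‖) atTop (𝓝 0) := by
  obtain ⟨c, C, hc, h⟩ := hb
  have h1 : Tendsto (fun n => ∑ i ∈ Finset.range n, b.coord i x • b i) atTop (𝓝 x) := by
    have h0 := b.expansion x
    rw [HasSum, SummationFilter.conditional_filter_eq_map_range, tendsto_map'_iff] at h0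
    exact h0
  have h2 : Tendsto (fun n => b.coord n x • b n) atTop (𝓝 0) := by
    have := (h1.comp (tendsto_add_atTop_nat 1)).sub h1
    simpa [Finset.sum_range_succ, Function.comp_def] using this
  have h3 : Tendsto (fun n => ‖b.coord n x • b n‖ / c) atTop (𝓝 0) := by
    simpa using h2.norm.div_const c
  refine squeeze_zero (fun _ => norm_nonneg _) (fun n => ?_) h3
  rw [le_div_iff₀ hc, norm_smul]
  exact mul_le_mul_of_nonneg_left (h n).1 (norm_nonneg _)

/-- Every vector has a greedy ordering. -/
theorem exists_isGreedyOrdering (b : SchauderBasis 𝕜 X) (hb : b.IsSemiNormalized) (x : X) :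
    ∃ ρ : ℕ → ℕ, b.IsGreedyOrdering x ρ := by
  classical
  have hfin : ∀ t : ℝ, 0 < t → {n : ℕ | t ≤ ‖b.coord n x‖}.Finite := by
    intro t ht
    have h := (b.tendsto_norm_coord hb x).eventually (gt_mem_nhds ht)
    rw [← Nat.cofinite_eq_atTop, eventually_cofinite] at h
    simpa using h
  have hnext : ∀ A : Finset ℕ, ∃ n, n ∉ A ∧ ∀ k, k ∉ A → k ≠ n →
      ‖b.coord k x‖ < ‖b.coord n x‖ ∨ (‖b.coord n x‖ = ‖b.coord k x‖ ∧ n < k) := by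
    intro A
    have hmax : ∃ n, n ∉ A ∧ ∀ k, k ∉ A → ‖b.coord k x‖ ≤ ‖b.coord n x‖ := by
      by_cases h0 : ∃ k0, k0 ∉ A ∧ b.coord k0 x ≠ 0
      · obtain ⟨k0, hk0, hx⟩ := h0
        have hf : ({n : ℕ | ‖b.coord k0 x‖ ≤ ‖b.coord n x‖} \ A).Finite :=
          (hfin _ (norm_pos_iff.2 hx)).sdiff
        obtain ⟨n, hn, hmax⟩ := hf.exists_maximalFor (fun n => ‖b.coord n x‖) _
          ⟨k0, le_refl (‖b.coord k0 x‖), by simpa using hk0⟩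
        refine ⟨n, by simpa using hn.2, fun k hk => ?_⟩
        by_contra! hlt
        have hk' : k ∈ {n : ℕ | ‖b.coord k0 x‖ ≤ ‖b.coord n x‖} \ (A : Set ℕ) :=
          ⟨le_trans hn.1 hlt.le, by simpa using hk⟩
        exact absurd (hmax hk' hlt.le) (not_le.2 hlt)
      · push Not at h0
        obtain ⟨n, hn⟩ := Infinite.exists_notMem_finset A
        exact ⟨n, hn, fun k hk => by simp [h0 k hk]⟩
    obtain ⟨h1, h2⟩ := Nat.find_spec hmax
    refine ⟨Nat.find hmax, h1, fun k hk hne => ?_⟩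
    rcases (h2 k hk).lt_or_eq with h | h
    · exact Or.inl h
    · refine Or.inr ⟨h.symm, lt_of_le_of_ne (Nat.find_min' hmax ⟨hk, fun l hl => ?_⟩) hne.symm⟩
      rw [h]
      exact h2 l hl
  choose nxt hmem hord using hnext
  let S : ℕ → Finset ℕ := fun m => Nat.rec ∅ (fun _ A => insert (nxt A) A) m
  have hS : ∀ m, S (m + 1) = insert (nxt (S m)) (S m) := fun _ => rfl
  have hmono : Monotone S := monotone_nat_of_le_succ fun m => by
    rw [hS]; exact Finset.subset_insert _ _
  have hin : ∀ j k, j < k → nxt (S j) ∈ S k := fun j k hjk =>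
    hmono (Nat.succ_le_of_lt hjk) (by rw [Nat.succ_eq_add_one, hS]; exact Finset.mem_insert_self _ _)
  have hne : ∀ j k, j < k → nxt (S k) ≠ nxt (S j) := fun j k hjk h =>
    hmem (S k) (h ▸ hin j k hjk)
  refine ⟨fun m => nxt (S m), fun n hn => ?_, fun j k hjk =>
    hord _ _ (fun h => hmem (S k) (hmono hjk.le h)) (hne j k hjk)⟩
  by_contra hr
  have hnot : ∀ m, n ∉ S m := by
    intro m
    induction m with
    | zero => exact Finset.notMem_empty n
    | succ m ih =>
      rw [hS, Finset.mem_insert]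
      rintro (h | h)
      · exact hr ⟨m, h.symm⟩
      · exact ih h
  have hle : ∀ m, ‖b.coord n x‖ ≤ ‖b.coord (nxt (S m)) x‖ := fun m => by
    rcases hord (S m) n (hnot m) (fun h => hr ⟨m, h.symm⟩) with h | h
    · exact h.le
    · exact h.1.ge
  have hinj : Function.Injective (fun m => nxt (S m)) := by
    intro j k hjk
    rcases lt_trichotomy j k with h | h | h
    · exact absurd hjk.symm (hne j k h)
    · exact h
    · exact absurd hjk (hne k j h)
  exact Set.infinite_range_of_injective hinj
    ((hfin _ (norm_pos_iff.2 hn)).subset (Set.range_subset_iff.2 hle))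

/-- Chebyshev-greedy sums exist. -/
theorem exists_isChebyshevSum (b : SchauderBasis 𝕜 X) (x : X) (A : Finset ℕ) :
    ∃ y : X, b.IsChebyshevSum x A y := by
  let W := Submodule.span 𝕜 (b.basis '' (A : Set ℕ))
  have : FiniteDimensional 𝕜 W :=
    FiniteDimensional.span_of_finite 𝕜 (A.finite_toSet.image b.basis)
  have : ProperSpace W := FiniteDimensional.proper 𝕜 W
  have hcont : Continuous fun w : W => ‖x - (w : X)‖ := by fun_prop
  have hev : ∀ᶠ w : W in cocompact W, ‖x - ((0 : W) : X)‖ ≤ ‖x - (w : X)‖ := by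
    filter_upwards [(tendsto_norm_cocompact_atTop (E := W)).eventually_ge_atTop (2 * ‖x‖)]
      with w hw
    have h1 : ‖(w : X)‖ - ‖x‖ ≤ ‖x - (w : X)‖ := by
      rw [norm_sub_rev]; exact norm_sub_norm_le _ _
    have h2 : ‖w‖ = ‖(w : X)‖ := rfl
    simp only [ZeroMemClass.coe_zero, sub_zero]
    linarith
  obtain ⟨y, hy⟩ := hcont.exists_forall_le' (0 : W) hev
  refine ⟨y, y.2, fun a => hy ⟨∑ n ∈ A, a n • b n, ?_⟩⟩
  exact Submodule.sum_mem _ fun n hn =>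
    Submodule.smul_mem _ _ (Submodule.subset_span ⟨n, hn, rfl⟩)

end SchauderBasis

namespace SchauderBasis

variable {𝕜 X : Type*} [RCLike 𝕜] [NormedAddCommGroup X] [NormedSpace 𝕜 X]

/-! Both properties are equivalent to quasi-greediness together with democracy, here stated for
combinations whose coefficients are separated by a level `t`.

From these two properties, both greedy bounds follow by splitting off a greedy set of the
competitor's residual `w = x - ∑_{n ∈ B} a_n e_n`. Quasi-greediness controls what is left of `w` and
the part split off, and democracy dominates the correction on `B \ A` by that part.

Conversely, each greedy property is tested on vectors `x + t ∑_{n ∈ D} e_n` or on sums of two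
disjoint blocks. The set `D` lies beyond the support of `x`, so in the semi-greedy case the
uniformly bounded partial sum projections separate `x` from the block. This matters because a
Chebyshev approximation may change the coefficients on the greedy set arbitrarily.

The definitions use greedy orderings, which break ties. A small perturbation makes any prescribed
greedy set the one selected. -/

/-- The linear combination `∑_{n ∈ A} a_n e_n`. -/
noncomputable def linComb (b : SchauderBasis 𝕜 X) (A : Finset ℕ) (a : ℕ → 𝕜) : X :=
  ∑ n ∈ A, a n • b n

theorem coord_linComb (b : SchauderBasis 𝕜 X) (A : Finset ℕ) (a : ℕ → 𝕜) (k : ℕ) :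
    b.coord k (b.linComb A a) = if k ∈ A then a k else 0 := by
  simp [linComb, map_sum, b.ortho, Pi.single_apply]

theorem eq_of_coord_eq (b : SchauderBasis 𝕜 X) {x y : X}
    (h : ∀ n, b.coord n x = b.coord n y) : x = y := by
  refine tendsto_nhds_unique (b.tendsto_proj x) ?_
  have : (fun n => b.proj n x) = fun n => b.proj n y := by
    funext n
    simp [h]
  rw [this]
  exact b.tendsto_proj y

/-! ### Greedy sets and greedy orderings -/

/-- A finite set of indices is greedy for `x` if the coefficients of `x` on it are, in modulus,
at least as large as the remaining ones. -/
def IsGreedySet (b : SchauderBasis 𝕜 X) (x : X) (A : Finset ℕ) : Prop :=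
  ∃ t : ℝ, (∀ n ∈ A, t ≤ ‖b.coord n x‖) ∧ ∀ n ∉ A, ‖b.coord n x‖ ≤ t

/-- Removing the part of a vector on a greedy set increases its norm at most `C` times. -/
def QuasiGreedyWith (b : SchauderBasis 𝕜 X) (C : ℝ) : Prop :=
  ∀ (x : X) (A : Finset ℕ), b.IsGreedySet x A →
    ‖x - b.linComb A (fun n => b.coord n x)‖ ≤ C * ‖x‖

/-- Democracy for linear combinations: a combination with coefficients of modulus at most `t` is
dominated by each combination of at least as many basis vectors, with coefficients of modulus at
least `t`. -/
def DemocraticWith (b : SchauderBasis 𝕜 X) (C : ℝ) : Prop :=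
  ∀ (A B : Finset ℕ) (a c : ℕ → 𝕜) (t : ℝ), A.card ≤ B.card → (∀ n ∈ A, ‖a n‖ ≤ t) →
    (∀ n ∈ B, t ≤ ‖c n‖) → ‖b.linComb A a‖ ≤ C * ‖b.linComb B c‖

theorem IsGreedyOrdering.injective {b : SchauderBasis 𝕜 X} {x : X} {ρ : ℕ → ℕ}
    (h : b.IsGreedyOrdering x ρ) : Function.Injective ρ := by
  intro j k hjk
  rcases lt_trichotomy j k with hlt | heq | hlt
  · rcases h.2 j k hlt with h1 | h1
    · rw [hjk] at h1; exact absurd h1 (lt_irrefl _)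
    · rw [hjk] at h1; exact absurd h1.2 (lt_irrefl _)
  · exact heq
  · rcases h.2 k j hlt with h1 | h1
    · rw [hjk] at h1; exact absurd h1 (lt_irrefl _)
    · rw [hjk] at h1; exact absurd h1.2 (lt_irrefl _)

theorem IsGreedyOrdering.antitone {b : SchauderBasis 𝕜 X} {x : X} {ρ : ℕ → ℕ}
    (h : b.IsGreedyOrdering x ρ) : Antitone fun n => ‖b.coord (ρ n) x‖ := by
  intro j k hjk
  rcases hjk.lt_or_eq with hlt | rfl
  · rcases h.2 j k hlt with h1 | h1
    · exact h1.le
    · exact h1.1.ge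
  · exact le_rfl

theorem IsGreedyOrdering.card_greedySet {b : SchauderBasis 𝕜 X} {x : X} {ρ : ℕ → ℕ}
    (h : b.IsGreedyOrdering x ρ) (m : ℕ) : (greedySet ρ m).card = m := by
  rw [greedySet, Finset.card_image_of_injective _ h.injective, Finset.card_range]

theorem IsGreedyOrdering.greedySum_eq {b : SchauderBasis 𝕜 X} {x : X} {ρ : ℕ → ℕ}
    (h : b.IsGreedyOrdering x ρ) (m : ℕ) :
    b.greedySum x ρ m = b.linComb (greedySet ρ m) (fun n => b.coord n x) := by
  rw [greedySum, linComb, greedySet, Finset.sum_image h.injective.injOn]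

theorem IsGreedyOrdering.isGreedySet {b : SchauderBasis 𝕜 X} {x : X} {ρ : ℕ → ℕ}
    (h : b.IsGreedyOrdering x ρ) (m : ℕ) : b.IsGreedySet x (greedySet ρ m) := by
  refine ⟨‖b.coord (ρ m) x‖, fun n hn => ?_, fun n hn => ?_⟩
  · obtain ⟨j, hj, rfl⟩ := Finset.mem_image.1 hn
    exact h.antitone (Finset.mem_range.1 hj).le
  · by_cases h0 : b.coord n x = 0
    · simp [h0]
    · obtain ⟨j, rfl⟩ := h.1 h0
      refine h.antitone (not_lt.1 fun hj => hn ?_)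
      exact Finset.mem_image_of_mem _ (Finset.mem_range.2 hj)

/-- A set on which the coefficients are strictly larger than elsewhere is selected by each greedy
ordering. -/
theorem IsGreedyOrdering.greedySet_eq {b : SchauderBasis 𝕜 X} {x : X} {ρ : ℕ → ℕ}
    (h : b.IsGreedyOrdering x ρ) {A : Finset ℕ}
    (hA : ∀ n ∈ A, ∀ k ∉ A, ‖b.coord k x‖ < ‖b.coord n x‖) : greedySet ρ A.card = A := by
  refine Finset.eq_of_subset_of_card_le (fun n hn => ?_) (h.card_greedySet _).ge
  obtain ⟨j, hj, rfl⟩ := Finset.mem_image.1 hn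
  by_contra hjA
  have hsub : A ⊆ greedySet ρ j := by
    intro n hnA
    have h0 : b.coord n x ≠ 0 :=
      norm_pos_iff.1 ((norm_nonneg _).trans_lt (hA n hnA _ hjA))
    obtain ⟨i, rfl⟩ := h.1 h0
    refine Finset.mem_image_of_mem _ (Finset.mem_range.2 (not_le.1 fun hji => ?_))
    exact absurd (hA _ hnA _ hjA) (not_lt.2 (h.antitone hji))
  have := Finset.card_le_card hsub
  rw [h.card_greedySet] at this
  exact absurd (Finset.mem_range.1 hj) (not_lt.2 this)

/-! ### Perturbation, padding and truncation -/

theorem exists_norm_add_smul_eq (a : 𝕜) :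
    ∃ u : 𝕜, ∀ δ : ℝ, 0 ≤ δ → ‖a + (δ : 𝕜) * u‖ = ‖a‖ + δ := by
  obtain ⟨u, hu, ha⟩ : ∃ u : 𝕜, ‖u‖ = 1 ∧ a = (‖a‖ : 𝕜) * u := by
    by_cases h : a = 0
    · exact ⟨1, by simp, by simp [h]⟩
    · have h' : (‖a‖ : 𝕜) ≠ 0 := by simpa using h
      refine ⟨a / (‖a‖ : 𝕜), ?_, by field_simp⟩
      rw [norm_div, RCLike.norm_ofReal, abs_norm, div_self (norm_ne_zero_iff.2 h)]
  -- `u` carries the phase of `a`, so the moduli add; it does not depend on `δ`.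
  refine ⟨u, fun δ hδ => ?_⟩
  have : a + (δ : 𝕜) * u = ((‖a‖ + δ : ℝ) : 𝕜) * u := by
    conv_lhs => rw [ha]
    push_cast
    ring
  rw [this, norm_mul, hu, mul_one, RCLike.norm_ofReal, abs_of_nonneg (by positivity)]

/-- A greedy set becomes strictly greedy after an arbitrarily small perturbation on it. -/
theorem IsGreedySet.exists_perturbation {b : SchauderBasis 𝕜 X} {x : X} {A : Finset ℕ}
    (h : b.IsGreedySet x A) : ∃ u : ℕ → 𝕜, ∀ δ : ℝ, 0 < δ → ∀ n ∈ A, ∀ k ∉ A,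
      ‖b.coord k (x + (δ : 𝕜) • b.linComb A u)‖ < ‖b.coord n (x + (δ : 𝕜) • b.linComb A u)‖ := by
  obtain ⟨t, h1, h2⟩ := h
  choose u hu using fun n => exists_norm_add_smul_eq (b.coord n x)
  refine ⟨u, fun δ hδ n hn k hk => ?_⟩
  simp only [map_add, map_smul, coord_linComb, hn, hk, if_true, if_false, smul_eq_mul, mul_zero,
    add_zero]
  rw [hu n δ hδ.le]
  linarith [h1 n hn, h2 k hk]

/-- Lets the size `δ` of the tie-breaking perturbation tend to `0`. -/
theorem le_of_forall_pos_le_mul_add {p q C M : ℝ} (h : ∀ δ : ℝ, 0 < δ → p ≤ C * (q + δ * M)) :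
    p ≤ C * q := by
  have hc : Tendsto (fun δ : ℝ => C * (q + δ * M)) (𝓝[>] 0) (𝓝 (C * (q + 0 * M))) :=
    Continuous.tendsto (by fun_prop) 0 |>.mono_left nhdsWithin_le_nhds
  have := ge_of_tendsto hc (eventually_mem_nhdsWithin.mono fun δ hδ => h δ hδ)
  simpa using this

theorem sigmaTilde_le (b : SchauderBasis 𝕜 X) (x : X) (A : Finset ℕ) :
    b.sigmaTilde A.card x ≤ ‖x - b.linComb A (fun n => b.coord n x)‖ :=
  csInf_le ⟨0, by rintro r ⟨A, -, rfl⟩; exact norm_nonneg _⟩ ⟨A, rfl, rfl⟩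

theorem sigma_le (b : SchauderBasis 𝕜 X) (x : X) (A : Finset ℕ) (a : ℕ → 𝕜) :
    b.sigma A.card x ≤ ‖x - b.linComb A a‖ :=
  csInf_le ⟨0, by rintro r ⟨A, a, -, rfl⟩; exact norm_nonneg _⟩ ⟨A, a, rfl, rfl⟩

theorem exists_far_finset (N m : ℕ) : ∃ D : Finset ℕ, D.card = m ∧ ∀ n ∈ D, N ≤ n :=
  ⟨Finset.Ico N (N + m), by simp, fun _ hn => (Finset.mem_Ico.1 hn).1⟩

theorem coord_proj (b : SchauderBasis 𝕜 X) (N k : ℕ) (x : X) :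
    b.coord k (b.proj N x) = if k < N then b.coord k x else 0 := by
  have := b.coord_linComb (Finset.range N) (fun n => b.coord n x) k
  simpa only [linComb, Finset.mem_range, ← proj_apply] using this

/-- Dropping the coefficients from some index on costs at most the basis constant. -/
theorem norm_le_mul_norm_of_coord_eq {b : SchauderBasis 𝕜 X} {K : ℝ}
    (hK : ∀ n, ‖b.proj n‖ ≤ K) {x y : X} (N : ℕ) (h1 : ∀ n < N, b.coord n x = b.coord n y)
    (h2 : ∀ n ≥ N, b.coord n x = 0) : ‖x‖ ≤ K * ‖y‖ := by
  have : x = b.proj N y := b.eq_of_coord_eq fun n => by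
    rw [coord_proj]
    split_ifs with hn
    · exact h1 n hn
    · exact h2 n (not_lt.1 hn)
  rw [this]
  exact (b.proj N).le_of_opNorm_le (hK N) y

theorem IsGreedySet.exists_nonneg_threshold {b : SchauderBasis 𝕜 X} {x : X} {A : Finset ℕ}
    (h : b.IsGreedySet x A) : ∃ t : ℝ, 0 ≤ t ∧ (∀ n ∈ A, t ≤ ‖b.coord n x‖) ∧
      ∀ n ∉ A, ‖b.coord n x‖ ≤ t := by
  obtain ⟨t, h1, h2⟩ := h
  obtain ⟨n, hn⟩ := Infinite.exists_notMem_finset A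
  exact ⟨t, (norm_nonneg _).trans (h2 n hn), h1, h2⟩

/-- Quasi-greediness for finitely supported vectors implies quasi-greediness. -/
theorem quasiGreedyWith_of_finite_support {b : SchauderBasis 𝕜 X} {C K : ℝ} (hC : 0 ≤ C)
    (hK : ∀ n, ‖b.proj n‖ ≤ K)
    (h : ∀ (x : X) (A : Finset ℕ) (N : ℕ), (∀ n ≥ N, b.coord n x = 0) → (∀ n ∈ A, n < N) →
      b.IsGreedySet x A → ‖x - b.linComb A (fun n => b.coord n x)‖ ≤ C * ‖x‖) :
    b.QuasiGreedyWith (C * K) := by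
  intro x A hA
  -- Since `0 ≤ t`, the coefficients killed by truncation stay below the threshold, so `A` remains
  -- greedy for `b.proj N x` once `N` exceeds `A`.
  obtain ⟨t, ht0, ht1, ht2⟩ := hA.exists_nonneg_threshold
  have hlim : Tendsto (fun N => ‖b.proj N x - b.linComb A (fun n => b.coord n x)‖) atTop
      (𝓝 ‖x - b.linComb A (fun n => b.coord n x)‖) :=
    ((b.tendsto_proj x).sub_const _).norm
  refine le_of_tendsto hlim ?_
  obtain ⟨M, hM⟩ := A.bddAbove
  filter_upwards [eventually_gt_atTop M] with N hN
  have hAN : ∀ n ∈ A, n < N := fun n hn => (hM hn).trans_lt hN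
  have key := h (b.proj N x) A N (fun n hn => by rw [coord_proj, if_neg (not_lt.2 hn)]) hAN
    ⟨t, fun n hn => by rw [coord_proj, if_pos (hAN n hn)]; exact ht1 n hn, fun n hn => by
      rw [coord_proj]
      split_ifs
      · exact ht2 n hn
      · simpa using ht0⟩
  have heq : b.linComb A (fun n => b.coord n (b.proj N x)) =
      b.linComb A (fun n => b.coord n x) :=
    Finset.sum_congr rfl fun n hn => by simp only [coord_proj, if_pos (hAN n hn)]
  rw [heq] at key
  rw [mul_assoc]
  exact key.trans (mul_le_mul_of_nonneg_left ((b.proj N).le_of_opNorm_le (hK N) x) hC)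

theorem exists_forall_lt (A : Finset ℕ) : ∃ N, ∀ n ∈ A, n < N := by
  obtain ⟨M, hM⟩ := A.bddAbove
  exact ⟨M + 1, fun n hn => Nat.lt_succ_of_le (hM hn)⟩

/-! ### Almost-greedy implies quasi-greedy and democratic -/

theorem norm_sub_le_of_almostGreedy {b : SchauderBasis 𝕜 X} (hb : b.IsSemiNormalized) {C : ℝ}
    (hC : 0 ≤ C)
    (h : ∀ (x : X) (ρ : ℕ → ℕ), b.IsGreedyOrdering x ρ →
      ∀ m : ℕ, ‖x - b.greedySum x ρ m‖ ≤ C * b.sigmaTilde m x)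
    {x : X} {N : ℕ} (hN : ∀ n ≥ N, b.coord n x = 0) {A B : Finset ℕ} (hA : b.IsGreedySet x A)
    (hBA : B.card ≤ A.card) :
    ‖x - b.linComb A (fun n => b.coord n x)‖ ≤
      C * ‖x - b.linComb B (fun n => b.coord n x)‖ := by
  obtain ⟨u, hu⟩ := hA.exists_perturbation
  obtain ⟨N', hN'⟩ := exists_forall_lt B
  -- `D` pads `B` to the cardinality of `A`. It lies beyond the support of `x`, so projecting it
  -- away does not change `x`.
  obtain ⟨D, hDcard, hD⟩ := exists_far_finset (max N N') (A.card - B.card)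
  have hdisj : Disjoint B D := Finset.disjoint_left.2 fun n hB hD' =>
    absurd ((le_max_right _ _).trans (hD n hD')) (not_le.2 (hN' n hB))
  have hcard : (B ∪ D).card = A.card := by
    rw [Finset.card_union_of_disjoint hdisj, hDcard]; omega
  set v := b.linComb A u with hv
  refine le_of_forall_pos_le_mul_add
    (M := ‖v - b.linComb (B ∪ D) (fun n => b.coord n v)‖) fun δ hδ => ?_
  obtain ⟨ρ, hρ⟩ := b.exists_isGreedyOrdering hb (x + (δ : 𝕜) • v)
  have hset := hρ.greedySet_eq (hu δ hδ)
  have key := h _ ρ hρ A.card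
  rw [hρ.greedySum_eq, hset] at key
  have e1 : x + (δ : 𝕜) • v - b.linComb A (fun n => b.coord n (x + (δ : 𝕜) • v)) =
      x - b.linComb A (fun n => b.coord n x) := b.eq_of_coord_eq fun n => by
    simp only [map_add, map_sub, map_smul, smul_eq_mul, coord_linComb, hv]
    split_ifs <;> ring
  have e2 : x + (δ : 𝕜) • v - b.linComb (B ∪ D) (fun n => b.coord n (x + (δ : 𝕜) • v)) =
      (x - b.linComb B (fun n => b.coord n x)) +
        (δ : 𝕜) • (v - b.linComb (B ∪ D) (fun n => b.coord n v)) := b.eq_of_coord_eq fun n => by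
    have h0 : n ∈ D → b.coord n x = 0 := fun hn => hN n ((le_max_left _ _).trans (hD n hn))
    simp only [map_add, map_sub, map_smul, smul_eq_mul, coord_linComb, Finset.mem_union]
    by_cases hnB : n ∈ B <;> by_cases hnD : n ∈ D <;> simp [hnB, hnD, h0]
  rw [e1] at key
  refine key.trans (mul_le_mul_of_nonneg_left ?_ hC)
  rw [← hcard]
  refine (b.sigmaTilde_le _ _).trans ?_
  rw [e2]
  refine (norm_add_le _ _).trans (le_of_eq ?_)
  rw [norm_smul, RCLike.norm_ofReal, abs_of_pos hδ]

/-- A negative bound on norms forces `A` to be empty; this settles the degenerate levels allowed by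
`DemocraticWith`. -/
theorem linComb_eq_zero_of_norm_le_of_neg {b : SchauderBasis 𝕜 X} {A : Finset ℕ} {a : ℕ → 𝕜} {t : ℝ}
    (ht : t < 0) (ha : ∀ n ∈ A, ‖a n‖ ≤ t) : b.linComb A a = 0 :=
  Finset.sum_eq_zero fun n hn => absurd ((norm_nonneg _).trans (ha n hn)) (not_le.2 ht)

theorem quasiGreedy_democratic_of_almostGreedy [CompleteSpace X] {b : SchauderBasis 𝕜 X}
    (hb : b.IsSemiNormalized) (h : b.IsAlmostGreedy) :
    ∃ C₁ C₂ : ℝ, 0 ≤ C₁ ∧ 0 ≤ C₂ ∧ b.QuasiGreedyWith C₁ ∧ b.DemocraticWith C₂ := by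
  obtain ⟨C, hC1, h⟩ := h
  have hC : 0 ≤ C := by linarith
  obtain ⟨K, hK⟩ := b.exists_norm_proj_le
  have hK0 : 0 ≤ K := (norm_nonneg _).trans (hK 0)
  refine ⟨C * K, C * C, by positivity, by positivity,
    quasiGreedyWith_of_finite_support hC hK fun x A N hN _ hx => ?_, ?_⟩
  · simpa [linComb] using norm_sub_le_of_almostGreedy hb hC h hN (B := ∅) hx (by simp)
  -- For disjoint sets, `B` is greedy for the sum of the two combinations: removing `B` leaves the
  -- first one, and the competitor `A` leaves the second.
  have hdisj : ∀ (A B : Finset ℕ) (a c : ℕ → 𝕜) (t : ℝ), 0 ≤ t → Disjoint A B →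
      A.card ≤ B.card → (∀ n ∈ A, ‖a n‖ ≤ t) → (∀ n ∈ B, t ≤ ‖c n‖) →
      ‖b.linComb A a‖ ≤ C * ‖b.linComb B c‖ := by
    intro A B a c t ht hAB hcard ha hc
    rw [Finset.disjoint_left] at hAB
    obtain ⟨N, hN⟩ := exists_forall_lt (A ∪ B)
    have hco : ∀ n, b.coord n (b.linComb A a + b.linComb B c) =
        (if n ∈ A then a n else 0) + if n ∈ B then c n else 0 := fun n => by
      simp only [map_add, coord_linComb]
    have key := norm_sub_le_of_almostGreedy hb hC h
      (x := b.linComb A a + b.linComb B c) (N := N) (A := B) (B := A)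
      (fun n hn => by
        rw [hco, if_neg, if_neg, add_zero]
        · exact fun hB => absurd (hN n (Finset.mem_union_right _ hB)) (not_lt.2 hn)
        · exact fun hB => absurd (hN n (Finset.mem_union_left _ hB)) (not_lt.2 hn))
      ⟨t, fun n hn => by
        rw [hco, if_neg (fun hA => hAB hA hn), if_pos hn, zero_add]
        exact hc n hn, fun n hn => by
        rw [hco, if_neg hn, add_zero]
        split_ifs with hA
        · exact ha n hA
        · simpa using ht⟩ hcard
    have e1 : b.linComb A a + b.linComb B c -
        b.linComb B (fun n => b.coord n (b.linComb A a + b.linComb B c)) = b.linComb A a :=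
      b.eq_of_coord_eq fun n => by
        simp only [map_add, map_sub, coord_linComb]
        grind
    have e2 : b.linComb A a + b.linComb B c -
        b.linComb A (fun n => b.coord n (b.linComb A a + b.linComb B c)) = b.linComb B c :=
      b.eq_of_coord_eq fun n => by
        simp only [map_add, map_sub, coord_linComb]
        grind
    rwa [e1, e2] at key
  intro A B a c t hcard ha hc
  rcases lt_or_ge t 0 with ht | ht
  · rw [linComb_eq_zero_of_norm_le_of_neg ht ha, norm_zero]
    positivity
  obtain ⟨N, hN⟩ := exists_forall_lt (A ∪ B)
  -- Overlapping sets are compared through a third set disjoint from both, whence the constant `C *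
  -- C`.
  obtain ⟨D, hDcard, hD⟩ := exists_far_finset N A.card
  have hfar : ∀ n ∈ A ∪ B, n ∉ D := fun n hn hnD =>
    absurd (hN n hn) (not_lt.2 (hD n hnD))
  have hnorm : ‖(t : 𝕜)‖ = t := by rw [RCLike.norm_ofReal, abs_of_nonneg ht]
  have s1 := hdisj A D a (fun _ => (t : 𝕜)) t ht
    (Finset.disjoint_left.2 fun n hn => hfar n (Finset.mem_union_left _ hn)) hDcard.ge ha
    (fun _ _ => hnorm.ge)
  have s2 := hdisj D B (fun _ => (t : 𝕜)) c t ht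
    (Finset.disjoint_right.2 fun n hn => hfar n (Finset.mem_union_right _ hn))
    (hDcard.trans_le hcard) (fun _ _ => hnorm.le) hc
  rw [mul_assoc]
  exact s1.trans (mul_le_mul_of_nonneg_left s2 hC)

/-! ### Quasi-greedy and democratic implies almost-greedy and semi-greedy -/

theorem QuasiGreedyWith.norm_linComb_le {b : SchauderBasis 𝕜 X} {C : ℝ}
    (h : b.QuasiGreedyWith C) {x : X} {A : Finset ℕ} (hA : b.IsGreedySet x A) :
    ‖b.linComb A (fun n => b.coord n x)‖ ≤ (1 + C) * ‖x‖ := by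
  have h1 := norm_sub_le x (x - b.linComb A (fun n => b.coord n x))
  rw [sub_sub_cancel] at h1
  linarith [h x A hA]

theorem isAlmostGreedy_of_quasiGreedy_democratic {b : SchauderBasis 𝕜 X} {C₁ C₂ : ℝ}
    (hC₁ : 0 ≤ C₁) (hC₂ : 0 ≤ C₂) (hQ : b.QuasiGreedyWith C₁) (hD : b.DemocraticWith C₂) :
    b.IsAlmostGreedy := by
  refine ⟨1 + (C₁ + C₂ * (1 + C₁)), by nlinarith [mul_nonneg hC₂ hC₁], fun x ρ hρ m => ?_⟩
  have hpos : 0 < 1 + (C₁ + C₂ * (1 + C₁)) := by positivity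
  rw [← div_le_iff₀' hpos]
  refine le_csInf ?_ ?_
  · exact ⟨_, Finset.range m, Finset.card_range m, rfl⟩
  rintro r ⟨B, hB, rfl⟩
  rw [div_le_iff₀' hpos, hρ.greedySum_eq]
  obtain ⟨t, ht, ht1, ht2⟩ := (hρ.isGreedySet m).exists_nonneg_threshold
  have hAcard := hρ.card_greedySet m
  set A := greedySet ρ m
  change _ ≤ _ * ‖x - b.linComb B (fun n => b.coord n x)‖
  set w := x - b.linComb B (fun n => b.coord n x) with hw
  have hwn : ∀ n, b.coord n w = if n ∈ B then 0 else b.coord n x := fun n => by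
    simp only [hw, map_sub, coord_linComb]
    split_ifs <;> simp
  have hG : b.IsGreedySet w (A \ B) := by
    refine ⟨t, fun n hn => ?_, fun n hn => ?_⟩
    · rw [Finset.mem_sdiff] at hn
      rw [hwn, if_neg hn.2]
      exact ht1 n hn.1
    · rw [hwn]
      split_ifs with hnB
      · simpa using ht
      · exact ht2 n fun hnA => hn (Finset.mem_sdiff.2 ⟨hnA, hnB⟩)
  -- The greedy residual is `w` without its greedy part on `A \ B`, plus the terms on `B \ A`. The
  -- latter have coefficients at most `t`, so democracy bounds them by the part on `A \ B`.
  have heq : x - b.linComb A (fun n => b.coord n x) =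
      (w - b.linComb (A \ B) (fun n => b.coord n w)) +
        b.linComb (B \ A) (fun n => b.coord n x) := b.eq_of_coord_eq fun n => by
    simp only [map_add, map_sub, coord_linComb, hwn, Finset.mem_sdiff]
    grind
  have h1 := hQ w _ hG
  have h2 := hQ.norm_linComb_le hG
  have h3 := hD (B \ A) (A \ B) (fun n => b.coord n x) (fun n => b.coord n w) t
    (Finset.card_sdiff_comm (hB.trans hAcard.symm)).le
    (fun n hn => ht2 n (Finset.mem_sdiff.1 hn).2)
    (fun n hn => by
      rw [Finset.mem_sdiff] at hn
      simp only [hwn, if_neg hn.2]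
      exact ht1 n hn.1)
  have h4 := mul_le_mul_of_nonneg_left h2 hC₂
  rw [heq]
  linarith [norm_add_le (w - b.linComb (A \ B) (fun n => b.coord n w))
    (b.linComb (B \ A) (fun n => b.coord n x)), norm_nonneg w]

/-- By minimality of `y`, it suffices to exhibit one vector `v` of norm at most a constant times
`‖w‖` that agrees with `x` off `A`. -/
theorem isSemiGreedy_of_quasiGreedy_democratic {b : SchauderBasis 𝕜 X} {C₁ C₂ : ℝ}
    (hC₁ : 0 ≤ C₁) (hC₂ : 0 ≤ C₂) (hQ : b.QuasiGreedyWith C₁) (hD : b.DemocraticWith C₂) :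
    b.IsSemiGreedy := by
  refine ⟨1 + (C₁ + C₂ * (2 * (1 + C₁))), by nlinarith [mul_nonneg hC₂ hC₁],
    fun x ρ hρ m y hy => ?_⟩
  have hpos : 0 < 1 + (C₁ + C₂ * (2 * (1 + C₁))) := by positivity
  rw [← div_le_iff₀' hpos]
  refine le_csInf ?_ ?_
  · exact ⟨_, Finset.range m, 0, Finset.card_range m, rfl⟩
  rintro r ⟨B, a, hB, rfl⟩
  rw [div_le_iff₀' hpos]
  obtain ⟨t, ht, ht1, ht2⟩ := (hρ.isGreedySet m).exists_nonneg_threshold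
  have hAcard := hρ.card_greedySet m
  set A := greedySet ρ m
  change _ ≤ _ * ‖x - b.linComb B a‖
  set w := x - b.linComb B a with hw
  have hwn : ∀ n ∉ B, b.coord n w = b.coord n x := fun n hn => by
    simp [hw, map_sub, coord_linComb, hn]
  -- Off `B`, `w` has the coefficients of `x`. Hence `G` contains `A \ B`, and no coefficient
  -- outside `G` exceeds `t`.
  set G := (A ∪ B).filter fun n => t ≤ ‖b.coord n w‖ with hGdef
  have hGt : ∀ n ∈ G, t ≤ ‖b.coord n w‖ := fun n hn => (Finset.mem_filter.1 hn).2
  have hGt' : ∀ n ∉ G, ‖b.coord n w‖ ≤ t := fun n hn => by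
    by_cases hn' : n ∈ A ∪ B
    · by_contra! hlt
      exact hn (Finset.mem_filter.2 ⟨hn', hlt.le⟩)
    · rw [Finset.mem_union, not_or] at hn'
      rw [hwn n hn'.2]
      exact ht2 n hn'.1
  have hG : b.IsGreedySet w G := ⟨t, hGt, hGt'⟩
  -- `d` is the correction restoring the coefficients of `x` on `B \ A` after `G` has been removed
  -- from `w`.
  let d : ℕ → 𝕜 := fun n => b.coord n x - if n ∈ G then 0 else b.coord n w
  set v := (w - b.linComb G (fun n => b.coord n w)) + b.linComb (B \ A) d with hv
  have hyv : ‖x - y‖ ≤ ‖v‖ := by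
    have heq : x - b.linComb A (fun n => b.coord n (x - v)) = v := b.eq_of_coord_eq fun n => by
      have hsub : n ∈ G → n ∈ A ∨ n ∈ B := fun hn =>
        Finset.mem_union.1 (Finset.mem_filter.1 hn).1
      have := hwn n
      simp only [hv, d, map_add, map_sub, coord_linComb, Finset.mem_sdiff]
      grind
    rw [← heq]
    exact hy.2 _
  have hd : ∀ n ∈ B \ A, ‖d n‖ ≤ 2 * t := fun n hn => by
    have h1 := ht2 n (Finset.mem_sdiff.1 hn).2
    simp only [d]
    split_ifs with hnG
    · rw [sub_zero]; linarith
    · linarith [norm_sub_le (b.coord n x) (b.coord n w), hGt' n hnG]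
  have hcard : (B \ A).card ≤ G.card := by
    rw [Finset.card_sdiff_comm (hB.trans hAcard.symm)]
    refine Finset.card_le_card fun n hn => ?_
    rw [Finset.mem_sdiff] at hn
    refine Finset.mem_filter.2 ⟨Finset.mem_union_left _ hn.1, ?_⟩
    rw [hwn n hn.2]
    exact ht1 n hn.1
  have h1 := hQ w _ hG
  have h2 := hQ.norm_linComb_le hG
  -- `d` is bounded only by `2 * t`, so the coefficients on `G` are doubled to reach the same level.
  have h3 := hD (B \ A) G d (fun n => 2 * b.coord n w) (2 * t) hcard hd (fun n hn => by
    rw [norm_mul, RCLike.norm_ofNat]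
    linarith [hGt n hn])
  have heq2 : b.linComb G (fun n => 2 * b.coord n w) =
      (2 : 𝕜) • b.linComb G (fun n => b.coord n w) := by
    simp only [linComb, Finset.smul_sum, smul_smul]
  rw [heq2, norm_smul, RCLike.norm_ofNat] at h3
  have h4 := mul_le_mul_of_nonneg_left h2 hC₂
  linarith [norm_add_le (w - b.linComb G (fun n => b.coord n w)) (b.linComb (B \ A) d),
    norm_nonneg w]

/-! ### Semi-greedy implies quasi-greedy and democratic -/

theorem exists_norm_sub_le_of_semiGreedy {b : SchauderBasis 𝕜 X} (hb : b.IsSemiNormalized) {C : ℝ}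
    (hC : 0 ≤ C)
    (h : ∀ (x : X) (ρ : ℕ → ℕ), b.IsGreedyOrdering x ρ →
      ∀ (m : ℕ) (y : X), b.IsChebyshevSum x (greedySet ρ m) y → ‖x - y‖ ≤ C * b.sigma m x)
    {x : X} {A B : Finset ℕ} (hA : b.IsGreedySet x A) (hBA : B.card ≤ A.card) (c : ℕ → 𝕜) :
    ∃ a : ℕ → 𝕜, ‖x - b.linComb A a‖ ≤ C * ‖x - b.linComb B c‖ := by
  have hspan : ∀ y ∈ Submodule.span 𝕜 (b.basis '' (A : Set ℕ)), ∃ a, y = b.linComb A a := by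
    intro y hy
    rw [← GeneralSchauderBasis.range_proj_eq_span] at hy
    obtain ⟨z, rfl⟩ := hy
    exact ⟨fun n => b.coord n z, GeneralSchauderBasis.proj_apply b A z⟩
  obtain ⟨u, hu⟩ := hA.exists_perturbation
  obtain ⟨B', hBB', hcard⟩ := Infinite.exists_superset_card_eq B A.card hBA
  -- A minimizer for the unperturbed `x` supplies coefficients independent of `δ`, which the limit
  -- `δ → 0` requires.
  obtain ⟨y₀, hy₀, hmin⟩ := b.exists_isChebyshevSum x A
  obtain ⟨a₀, rfl⟩ := hspan y₀ hy₀
  refine ⟨a₀, ?_⟩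
  refine le_of_forall_pos_le_mul_add (M := ‖b.linComb A u‖) fun δ hδ => ?_
  obtain ⟨ρ, hρ⟩ := b.exists_isGreedyOrdering hb (x + (δ : 𝕜) • b.linComb A u)
  have hset := hρ.greedySet_eq (hu δ hδ)
  obtain ⟨y, hy⟩ := b.exists_isChebyshevSum (x + (δ : 𝕜) • b.linComb A u) A
  have key := h _ ρ hρ A.card y (by rwa [hset])
  obtain ⟨a, rfl⟩ := hspan y hy.1
  have e1 : x + (δ : 𝕜) • b.linComb A u - b.linComb A a =
      x - b.linComb A (fun n => a n - δ * u n) := b.eq_of_coord_eq fun n => by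
    simp only [map_add, map_sub, map_smul, smul_eq_mul, coord_linComb]
    split_ifs <;> ring
  have e2 : x + (δ : 𝕜) • b.linComb A u - b.linComb B' (fun n => if n ∈ B then c n else 0) =
      (x - b.linComb B c) + (δ : 𝕜) • b.linComb A u := b.eq_of_coord_eq fun n => by
    have := @hBB' n
    simp only [map_add, map_sub, map_smul, smul_eq_mul, coord_linComb]
    grind
  rw [e1] at key
  refine (hmin _).trans (key.trans (mul_le_mul_of_nonneg_left ?_ hC))
  rw [← hcard]
  refine (b.sigma_le _ B' (fun n => if n ∈ B then c n else 0)).trans ?_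
  rw [e2]
  refine (norm_add_le _ _).trans (le_of_eq ?_)
  rw [norm_smul, RCLike.norm_ofReal, abs_of_pos hδ]

/-- Dropping the coefficients before some index costs at most one plus the basis constant. -/
theorem norm_le_one_add_mul_norm_of_coord_eq {b : SchauderBasis 𝕜 X} {K : ℝ}
    (hK : ∀ n, ‖b.proj n‖ ≤ K) {x y : X} (N : ℕ) (h1 : ∀ n < N, b.coord n x = 0)
    (h2 : ∀ n ≥ N, b.coord n x = b.coord n y) : ‖x‖ ≤ (1 + K) * ‖y‖ := by
  have : x = y - b.proj N y := b.eq_of_coord_eq fun n => by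
    rw [map_sub, coord_proj]
    split_ifs with hn
    · rw [h1 n hn, sub_self]
    · rw [h2 n (not_lt.1 hn), sub_zero]
  rw [this]
  linarith [norm_sub_le y (b.proj N y), (b.proj N).le_of_opNorm_le (hK N) y]

theorem quasiGreedy_democratic_of_semiGreedy [CompleteSpace X] {b : SchauderBasis 𝕜 X}
    (hb : b.IsSemiNormalized) (h : b.IsSemiGreedy) :
    ∃ C₁ C₂ : ℝ, 0 ≤ C₁ ∧ 0 ≤ C₂ ∧ b.QuasiGreedyWith C₁ ∧ b.DemocraticWith C₂ := by
  obtain ⟨C, hC1, h⟩ := h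
  have hC : 0 ≤ C := by linarith
  obtain ⟨K, hK⟩ := b.exists_norm_proj_le
  have hK0 : 0 ≤ K := (norm_nonneg _).trans (hK 0)
  have hnorm : ∀ t : ℝ, 0 ≤ t → ‖(t : 𝕜)‖ = t := fun t ht => by
    rw [RCLike.norm_ofReal, abs_of_nonneg ht]
  -- a constant combination on a far set is dominated by each vector with a large greedy set
  have hfar : ∀ (x : X) (A D : Finset ℕ) (N : ℕ) (t : ℝ), 0 ≤ t → (∀ n ≥ N, b.coord n x = 0) →
      (∀ n ∈ A, n < N) → (∀ n ∈ D, N ≤ n) → D.card ≤ A.card → (∀ n ∈ A, t ≤ ‖b.coord n x‖) →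
      (∀ n ∉ A, ‖b.coord n x‖ ≤ t) →
      ‖b.linComb D (fun _ => (t : 𝕜))‖ ≤ (1 + K) * C * ‖x‖ := by
    intro x A D N t ht hx hAN hDN hcard h1 h2
    -- `A` is greedy and the competitor `D` leaves exactly `x`. Changes on `A` do not reach the
    -- indices from `N` on, where the block is recovered.
    obtain ⟨a, ha⟩ := exists_norm_sub_le_of_semiGreedy hb hC h
      (x := x + b.linComb D (fun _ => (t : 𝕜))) (A := A) (B := D)
      ⟨t, fun n hn => by
        rw [map_add, coord_linComb, if_neg (fun hD => absurd (hAN n hn) (not_lt.2 (hDN n hD))),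
          add_zero]
        exact h1 n hn, fun n hn => by
        rw [map_add, coord_linComb]
        split_ifs with hD
        · rw [hx n (hDN n hD), zero_add, hnorm t ht]
        · rw [add_zero]; exact h2 n hn⟩ hcard (fun _ => (t : 𝕜))
    rw [add_sub_cancel_right] at ha
    have := norm_le_one_add_mul_norm_of_coord_eq hK (x := b.linComb D (fun _ => (t : 𝕜)))
      (y := x + b.linComb D (fun _ => (t : 𝕜)) - b.linComb A a) N
      (fun n hn => by
        rw [coord_linComb, if_neg (fun hD => absurd hn (not_lt.2 (hDN n hD)))])
      (fun n hn => by
        rw [map_sub, map_add, hx n hn, b.coord_linComb A,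
          if_neg (fun hA => absurd (hAN n hA) (not_lt.2 hn)), zero_add, sub_zero])
    rw [mul_assoc]
    exact this.trans (mul_le_mul_of_nonneg_left ha (by positivity))
  -- a vector with small coefficients is dominated by its sum with a constant far combination,
  -- up to a change of the vector on a set of indices
  have hnear : ∀ (x : X) (A D : Finset ℕ) (c : ℕ → 𝕜) (N : ℕ) (t : ℝ), 0 ≤ t →
      (∀ n ≥ N, b.coord n x = 0) → (∀ n ∈ D, N ≤ n) → A.card ≤ D.card →
      (∀ n, ‖b.coord n x‖ ≤ t) →
      ‖x‖ ≤ K * C * ‖x + b.linComb D (fun _ => (t : 𝕜)) - b.linComb A c‖ := by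
    intro x A D c N t ht hx hDN hcard h2
    -- The roles are exchanged: `D` is greedy and `A` competes, so changes on `D` leave the indices
    -- below `N`, hence `x`, intact.
    obtain ⟨d, hd⟩ := exists_norm_sub_le_of_semiGreedy hb hC h
      (x := x + b.linComb D (fun _ => (t : 𝕜))) (A := D) (B := A)
      ⟨t, fun n hn => by
        rw [map_add, coord_linComb, if_pos hn, hx n (hDN n hn), zero_add, hnorm t ht],
      fun n hn => by
        rw [map_add, coord_linComb, if_neg hn, add_zero]
        exact h2 n⟩ hcard c
    have := norm_le_mul_norm_of_coord_eq hK (x := x)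
      (y := x + b.linComb D (fun _ => (t : 𝕜)) - b.linComb D d) N
      (fun n hn => by
        have hnD : n ∉ D := fun hD => absurd hn (not_lt.2 (hDN n hD))
        rw [map_sub, map_add, coord_linComb, coord_linComb, if_neg hnD, if_neg hnD, add_zero,
          sub_zero]) hx
    rw [mul_assoc]
    exact this.trans (mul_le_mul_of_nonneg_left hd hK0)
  refine ⟨K * C * (1 + (1 + K) * C) * K, K * C * ((1 + K) * C), by positivity, by positivity,
    quasiGreedyWith_of_finite_support (by positivity) hK fun x A N hN hAN hx => ?_, ?_⟩
  · obtain ⟨t, ht, ht1, ht2⟩ := hx.exists_nonneg_threshold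
    obtain ⟨D, hDcard, hDN⟩ := exists_far_finset N A.card
    have s1 := hfar x A D N t ht hN hAN hDN hDcard.le ht1 ht2
    have hco : ∀ n, b.coord n (x - b.linComb A (fun n => b.coord n x)) =
        if n ∈ A then 0 else b.coord n x := fun n => by
      rw [map_sub, coord_linComb]
      split_ifs <;> simp
    -- The competitor on `A` puts back the removed part of `x`, leaving `x` plus the far block,
    -- which `s1` bounds by `‖x‖`.
    have s2 := hnear (x - b.linComb A (fun n => b.coord n x)) A D (fun n => - b.coord n x) N t ht
      (fun n hn => by rw [hco, hN n hn, ite_self]) hDN hDcard.ge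
      (fun n => by
        rw [hco]
        split_ifs with hA
        · simpa using ht
        · exact ht2 n hA)
    have e : x - b.linComb A (fun n => b.coord n x) + b.linComb D (fun _ => (t : 𝕜)) -
        b.linComb A (fun n => - b.coord n x) = x + b.linComb D (fun _ => (t : 𝕜)) := by
      simp only [linComb, neg_smul, Finset.sum_neg_distrib]
      abel
    rw [e] at s2
    rw [mul_assoc]
    refine s2.trans (mul_le_mul_of_nonneg_left ?_ (by positivity))
    linarith [norm_add_le x (b.linComb D (fun _ => (t : 𝕜)))]
  · intro A B a c t hcard ha hc
    rcases lt_or_ge t 0 with ht | ht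
    · rw [linComb_eq_zero_of_norm_le_of_neg ht ha, norm_zero]
      positivity
    obtain ⟨N, hN⟩ := exists_forall_lt (A ∪ B)
    have hAN : ∀ n ∈ A, n < N := fun n hn => hN n (Finset.mem_union_left _ hn)
    have hBN : ∀ n ∈ B, n < N := fun n hn => hN n (Finset.mem_union_right _ hn)
    obtain ⟨D, hDcard, hDN⟩ := exists_far_finset N A.card
    have s1 := hfar (b.linComb B c) B D N t ht
      (fun n hn => by
        rw [coord_linComb, if_neg (fun hB => absurd (hBN n hB) (not_lt.2 hn))])
      hBN hDN (hDcard.trans_le hcard)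
      (fun n hn => by rw [coord_linComb, if_pos hn]; exact hc n hn)
      (fun n hn => by rw [coord_linComb, if_neg hn]; simpa using ht)
    -- The competitor cancels the combination on `A`, leaving only the far block, already dominated
    -- by the combination on `B`.
    have s2 := hnear (b.linComb A a) A D a N t ht
      (fun n hn => by
        rw [coord_linComb, if_neg (fun hA => absurd (hAN n hA) (not_lt.2 hn))])
      hDN hDcard.ge
      (fun n => by
        rw [coord_linComb]
        split_ifs with hA
        · exact ha n hA
        · simpa using ht)
    rw [add_sub_cancel_left] at s2
    rw [mul_assoc (K * C)]
    exact s2.trans (mul_le_mul_of_nonneg_left s1 (by positivity))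

end SchauderBasis

theorem corollary1p9 {𝕜 X : Type*} [RCLike 𝕜] [NormedAddCommGroup X] [NormedSpace 𝕜 X]
    [CompleteSpace X] (b : SchauderBasis 𝕜 X) (hb : b.IsSemiNormalized) :
    b.IsAlmostGreedy ↔ b.IsSemiGreedy := by
  constructor
  · intro h
    obtain ⟨C₁, C₂, hC₁, hC₂, hQ, hD⟩ :=
      SchauderBasis.quasiGreedy_democratic_of_almostGreedy hb h
    exact SchauderBasis.isSemiGreedy_of_quasiGreedy_democratic hC₁ hC₂ hQ hD
  · intro h
    obtain ⟨C₁, C₂, hC₁, hC₂, hQ, hD⟩ :=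
      SchauderBasis.quasiGreedy_democratic_of_semiGreedy hb h
    exact SchauderBasis.isAlmostGreedy_of_quasiGreedy_democratic hC₁ hC₂ hQ hD
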